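/- All logarithms are binary, and all set systems (set families) are finite families of finite sets. A family of sets is $\ell$-bounded if each of its members has at most $\ell$ elements. The VC-dimension $\mathsf{VC}(\mathcal H)$ of a nonempty family $\mathcal H$ is the largest size of a finite set $T$ such that for every $A\subseteq T$ there is $S\in\mathcal H$ with $T\cap S=A$ (and $\mathsf{VC}(\varnothing)=0$). A family of $r$ distinct sets is an $r$-sunflower if $A\cap B=A'\cap B'$ for all pairs $A\ne B$ and $A'\ne B'$ of its members. The iterated logarithm $\log^*\ell$ is the number of times the binary logarithm has to be applied to $\ell$ before the result becomes at most $1$. \textbf{Theorem.} There is a universal constant $C>0$ such that the following holds for all integers $\ell\ge 1$, $d\ge 2$ and $r\ge 0$. Let $\mathcal H$ be an $\ell$-bounded set system with $\mathsf{VC}(\mathcal H)\le d$. If \[ |\mathcal H|^{1/\ell}\;\ge\; C\,r\,(\log d+\log^*\ell), \] then $\mathcal H$ contains an $r$-sunflower, i.e. some subfamily of $\mathcal H$ is an $r$-sunflower. -/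

import Mathlib

/-- A finite family `S` of finite sets is an `r`-sunflower if it consists of `r` distinct sets and
the intersections of any two pairs of distinct members coincide. -/
def IsSunflower {α : Type*} [DecidableEq α] (r : ℕ) (S : Finset (Finset α)) : Prop :=
  S.card = r ∧
    ∀ A ∈ S, ∀ B ∈ S, A ≠ B → ∀ A' ∈ S, ∀ B' ∈ S, A' ≠ B' → A ∩ B = A' ∩ B'

/-- A set family is `ℓ`-bounded if all its members have size at most `ℓ`. -/
def IsBoundedFamily {α : Type*} (ℓ : ℕ) (H : Finset (Finset α)) : Prop :=
  ∀ A ∈ H, A.card ≤ ℓ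

/-- The iterated (binary) logarithm: the number of times the binary logarithm has to be applied
to `x` before the result becomes at most `1`. -/
noncomputable def logStar (x : ℝ) : ℕ :=
  sInf {k : ℕ | (Real.logb 2)^[k] x ≤ 1}

/-- The set of which `logStar` takes the minimum is never empty. -/
theorem exists_iterate_logb_le_one (x : ℝ) : ∃ k : ℕ, (Real.logb 2)^[k] x ≤ 1 := by
  obtain ⟨n, hn⟩ := exists_nat_ge x
  induction n generalizing x with
  | zero => exact ⟨0, by simp only [Function.iterate_zero, id]; push_cast at hn; linarith⟩
  | succ n ih =>
    by_cases h2 : x ≤ 2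
    · by_cases h1 : x ≤ 1
      · exact ⟨0, h1⟩
      · refine ⟨1, ?_⟩
        have hx : 0 < x := by linarith
        rw [Function.iterate_one, Real.logb_le_iff_le_rpow (by norm_num) hx]
        simpa using h2
    · have hx : 0 < x := by linarith
      have hlog : Real.logb 2 x ≤ x - 1 := by
        rw [Real.logb_le_iff_le_rpow (by norm_num) hx]
        have := one_add_mul_self_le_rpow_one_add (s := 1) (by norm_num) (p := x - 1) (by linarith)
        norm_num at this
        exact this
      obtain ⟨k, hk⟩ := ih (Real.logb 2 x) (by push_cast at hn; linarith)
      exact ⟨k + 1, by rwa [Function.iterate_succ_apply]⟩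

/-! Maximising `#{S ∈ H | Z ⊆ S} * (q / 2) ^ #Z` gives a core `Z` whose link is spread, so it is
enough to find `r` pairwise disjoint nonempty sets in the link; adding `Z` back gives the sunflower.
Colour the points uniformly by `2r × k` colours. For each `a < 2r`, strip the colours `(a, i)` from
the members one at a time, `i` going down from `k - 1` to `0`, and keep only remainders of size
below a threshold `x i`, where `x 0 = 1`. If a remainder survives to the end, some member is
coloured by `a` alone, and such members for different `a` are disjoint. Otherwise the link has a
cover which is cheap on average but, by spreadness, has weight at least 1 (`exists_fragment_cover`,
`exists_cover_of_traces`). Bounded VC-dimension enters through the number of traces on a remainder.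
By Sauer-Shelah a threshold can be exponential in the previous one, once `O(log d)` doublings have
made it exceed the dimension. Hence `k = O(log d + log* ℓ)` steps suffice. -/

/-! ### Fragmentation by recolouring -/

open Finset in
/-- The functions agreeing with a given one outside `u`. -/
theorem card_filter_agree_off {β K : Type*} [Fintype β] [DecidableEq β] [Fintype K]
    [DecidableEq K] (c : β → K) (u : Finset β) :
    #{c' : β → K | ∀ v ∉ u, c v = c' v} = Fintype.card K ^ #u := by
  have h : ({c' : β → K | ∀ v ∉ u, c v = c' v} : Finset (β → K)) =
      Fintype.piFinset fun v => if v ∈ u then univ else {c v} := by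
    ext c'
    simp only [mem_filter, mem_univ, true_and, Fintype.mem_piFinset]
    refine forall_congr' fun v => ?_
    by_cases hv : v ∈ u <;> simp [hv, eq_comm]
  rw [h, Fintype.card_piFinset]
  have : ∀ v, #(if v ∈ u then (univ : Finset K) else {c v}) =
      if v ∈ u then Fintype.card K else 1 := by
    intro v; split_ifs <;> simp
  simp [this]

open Finset Classical in
/-- One step of the fragmentation argument. For every colouring `c`, the members of `G c` that do
not contain a small remainder `T \ {v | c v = κ}` with `T ∈ G c` are covered by a family `U c`
whose members are traces on a member of `G`, and which is cheap on average. -/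
theorem exists_fragment_cover {β K : Type*} [Fintype β] [DecidableEq β] [Fintype K]
    [DecidableEq K] (G : (β → K) → Finset (Finset β)) (κ : K)
    (hG : ∀ c, ∀ S ∈ G c, ∀ T ⊆ S, G (fun v => if v ∈ T then κ else c v) = G c)
    (N x : ℕ) (hN : ∀ c, ∀ S ∈ G c, #((G c).image (S ∩ ·)) ≤ N)
    (q : ℝ) (hq : 0 ≤ q) (hKq : Fintype.card K * q ≤ 1) :
    ∃ U : (β → K) → Finset (Finset β),
      (∀ c, ∀ S ∈ G c, (∃ T ∈ G c, T.filter (c · ≠ κ) ⊆ S ∧ #(T.filter (c · ≠ κ)) < x) ∨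
        ∃ u ∈ U c, u ⊆ S) ∧
      ∑ c, ∑ u ∈ U c, q ^ #u ≤
        Fintype.card (β → K) * (N * (Fintype.card K * q) ^ x) := by
  have hhat : ∀ c, ∃ S, (∃ S ∈ G c, ∀ v ∈ S, c v = κ) → S ∈ G c ∧ ∀ v ∈ S, c v = κ := by
    intro c
    by_cases h : ∃ S ∈ G c, ∀ v ∈ S, c v = κ
    · obtain ⟨S, h1, h2⟩ := h
      exact ⟨S, fun _ => ⟨h1, h2⟩⟩
    · exact ⟨∅, fun h' => absurd h' h⟩
  choose hat hat_spec using hhat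
  let Tr : (β → K) → Finset (Finset β) := fun c =>
    if ∃ S ∈ G c, ∀ v ∈ S, c v = κ then {u ∈ (G c).image (hat c ∩ ·) | x ≤ #u} else ∅
  have hTr_card : ∀ c, #(Tr c) ≤ N := by
    intro c
    by_cases h : ∃ S ∈ G c, ∀ v ∈ S, c v = κ
    · simp only [Tr, if_pos h]
      exact (card_filter_le _ _).trans (hN c _ (hat_spec c h).1)
    · simp [Tr, if_neg h]
  have hTr_size : ∀ c, ∀ u ∈ Tr c, x ≤ #u := by
    intro c u hu
    by_cases h : ∃ S ∈ G c, ∀ v ∈ S, c v = κ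
    · simp only [Tr, if_pos h, mem_filter] at hu
      exact hu.2
    · simp [Tr, if_neg h] at hu
  refine ⟨fun c => {u | ∃ c', (∀ v ∉ u, c' v = c v) ∧ u ∈ Tr c'}, ?_, ?_⟩
  · intro c S hS
    by_contra! hcon
    obtain ⟨hbig, hcov⟩ := hcon
    -- Take the smallest remainder inside `S` and recolour it by `κ`. Then `T` is all `κ` under
    -- `c'`, so `hat c'` is a genuine member, chosen from `c'` alone.
    obtain ⟨T, hT, hmin⟩ := exists_min_image {T ∈ G c | T.filter (c · ≠ κ) ⊆ S}
      (fun T => #{v ∈ T | c v ≠ κ}) ⟨S, by simp [hS, filter_subset]⟩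
    rw [mem_filter] at hT
    set T₀ : Finset β := {v ∈ T | c v ≠ κ} with hT₀
    set c' : β → K := fun v => if v ∈ T₀ then κ else c v with hc'
    have hGc : G c' = G c := hG c S hS T₀ hT.2
    have hex : ∃ S ∈ G c', ∀ v ∈ S, c' v = κ := by
      refine ⟨T, by rw [hGc]; exact hT.1, fun v hv => ?_⟩
      by_cases h : c v = κ
      · simp [hc', h]
      · have : v ∈ T₀ := by simp [hT₀, hv, h]
        simp [hc', this]
    obtain ⟨h1, h2⟩ := hat_spec c' hex
    rw [hGc] at h1
    have hsub : {v ∈ hat c' | c v ≠ κ} ⊆ T₀ := by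
      intro v hv
      rw [mem_filter] at hv
      by_contra hvT
      have := h2 v hv.1
      simp only [hc', if_neg hvT] at this
      exact hv.2 this
    -- Minimality forces equality, so the recoloured set lies in the trace `hat c' ∩ S`, and `c` is
    -- recovered from `c'` by changing colours on that trace only.
    have heq : {v ∈ hat c' | c v ≠ κ} = T₀ :=
      eq_of_subset_of_card_le hsub
        (hmin _ (by rw [mem_filter]; exact ⟨h1, hsub.trans hT.2⟩))
    have hTu : T₀ ⊆ hat c' ∩ S :=
      subset_inter (heq ▸ filter_subset _ _) hT.2
    refine hcov (hat c' ∩ S) ?_ inter_subset_right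
    rw [mem_filter]
    refine ⟨mem_univ _, c', fun v hv => ?_, ?_⟩
    · have : v ∉ T₀ := fun h => hv (hTu h)
      simp [hc', this]
    · simp only [Tr, if_pos hex, mem_filter, mem_image]
      exact ⟨⟨S, by rw [hGc]; exact hS, rfl⟩, (hbig T hT.1 hT.2).trans (card_le_card hTu)⟩
  · have hKq0 : 0 ≤ Fintype.card K * q := by positivity
    -- Count triples `(c, c', u)`: a pair `(c', u)` leaves `|K| ^ #u` choices of `c`, and each `c'`
    -- has at most `N` traces `u`.
    calc ∑ c : β → K, ∑ u ∈ ({u | ∃ c', (∀ v ∉ u, c' v = c v) ∧ u ∈ Tr c'} : Finset _), q ^ #u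
        ≤ ∑ c : β → K, ∑ c' : β → K, ∑ u ∈ Tr c', if ∀ v ∉ u, c' v = c v then q ^ #u else 0 := by
          refine sum_le_sum fun c _ => ?_
          have h : ∀ c', ∑ u ∈ Tr c', (if ∀ v ∉ u, c' v = c v then q ^ #u else 0) =
              ∑ u, if u ∈ Tr c' then if ∀ v ∉ u, c' v = c v then q ^ #u else 0 else 0 := by
            intro c'; rw [sum_ite_mem, univ_inter]
          simp only [h]
          rw [sum_comm, sum_filter]
          refine sum_le_sum fun u _ => ?_
          split_ifs with hu
          · obtain ⟨c', h1, h2⟩ := hu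
            have := single_le_sum (s := univ) (f := fun c' : β → K =>
              if u ∈ Tr c' then if ∀ v ∉ u, c' v = c v then q ^ #u else 0 else 0)
              (fun _ _ => by split_ifs <;> positivity) (mem_univ c')
            simpa only [if_pos h1, if_pos h2] using this
          · exact sum_nonneg fun _ _ => by split_ifs <;> positivity
      _ = ∑ c' : β → K, ∑ u ∈ Tr c', ∑ c : β → K, if ∀ v ∉ u, c' v = c v then q ^ #u else 0 := by
          rw [sum_comm]
          exact sum_congr rfl fun _ _ => sum_comm
      _ = ∑ c' : β → K, ∑ u ∈ Tr c', (Fintype.card K * q) ^ #u := by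
          refine sum_congr rfl fun c' _ => sum_congr rfl fun u _ => ?_
          rw [← sum_filter, sum_const, nsmul_eq_mul, mul_pow]
          have := card_filter_agree_off c' u
          congr 1
          rw [← Nat.cast_pow, ← this]
      _ ≤ ∑ c' : β → K, N * (Fintype.card K * q) ^ x := by
          refine sum_le_sum fun c' _ => ?_
          calc _ ≤ ∑ u ∈ Tr c', (Fintype.card K * q) ^ x := sum_le_sum fun u hu =>
                pow_le_pow_of_le_one hKq0 hKq (hTr_size c' u hu)
            _ ≤ _ := by
                rw [sum_const, nsmul_eq_mul]
                gcongr
                exact hTr_card c'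
      _ = _ := by rw [sum_const, nsmul_eq_mul, card_univ]

/-! ### Counting traces -/

open Finset in
/-- The Sauer-Shelah bound for the traces of a family on a set. -/
theorem card_image_inter_le {α : Type*} [DecidableEq α] (F : Finset (Finset α)) (D : ℕ)
    (hF : ∀ A, F.Shatters A → #A ≤ D) (A : Finset α) :
    #(F.image (A ∩ ·)) ≤ (#A + 1) ^ D := by
  calc #(F.image (A ∩ ·)) ≤ #(F.image (A ∩ ·)).shatterer := card_le_card_shatterer _
    _ ≤ #((range (D + 1)).biUnion fun i => A.powersetCard i) := by
        refine card_le_card fun B hB => ?_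
        rw [mem_shatterer] at hB
        have hBA : B ⊆ A := by
          obtain ⟨T, hT, hBT⟩ := hB.exists_superset
          obtain ⟨S, -, rfl⟩ := mem_image.1 hT
          exact hBT.trans inter_subset_left
        have hBF : F.Shatters B := by
          intro C hC
          obtain ⟨T, hT, hBT⟩ := hB hC
          obtain ⟨S, hS, rfl⟩ := mem_image.1 hT
          refine ⟨S, hS, ?_⟩
          rw [← hBT, ← inter_assoc, inter_eq_left.2 hBA]
        simp only [mem_biUnion, mem_range, mem_powersetCard]
        exact ⟨#B, Nat.lt_succ_of_le (hF B hBF), hBA, rfl⟩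
    _ ≤ ∑ i ∈ range (D + 1), #(A.powersetCard i) := card_biUnion_le
    _ ≤ ∑ i ∈ range (D + 1), #A ^ i * 1 ^ (D - i) * D.choose i := by
        refine sum_le_sum fun i hi => ?_
        rw [card_powersetCard, one_pow, mul_one]
        calc _ ≤ #A ^ i := Nat.choose_le_pow _ _
          _ ≤ _ := Nat.le_mul_of_pos_right _
            (Nat.choose_pos (Nat.lt_succ_iff.1 (mem_range.1 hi)))
    _ = (#A + 1) ^ D := by rw [add_pow]; simp

theorem card_image_inter_le_two_pow {α ι : Type*} [DecidableEq α] (F : Finset ι)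
    (s : ι → Finset α) (A : Finset α) :
    (F.image fun j => A ∩ s j).card ≤ 2 ^ A.card := by
  rw [← Finset.card_powerset]
  refine Finset.card_le_card fun B hB => ?_
  obtain ⟨S, -, rfl⟩ := Finset.mem_image.1 hB
  exact Finset.mem_powerset.2 Finset.inter_subset_left

/-! ### Towers and size thresholds -/

/-- The tower function `1, 2, 4, 16, …`. -/
def tower : ℕ → ℕ
  | 0 => 1
  | n + 1 => 2 ^ tower n

theorem le_tower_of_iterate_logb_le_one (k : ℕ) (x : ℝ) (h : (Real.logb 2)^[k] x ≤ 1) :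
    x ≤ tower k := by
  induction k generalizing x with
  | zero => simpa [tower] using h
  | succ k ih =>
    rcases le_or_gt x 0 with hx | hx
    · exact hx.trans (Nat.cast_nonneg _)
    · rw [Function.iterate_succ_apply] at h
      have := ih _ h
      rw [Real.logb_le_iff_le_rpow (by norm_num) hx] at this
      simpa [tower] using this

theorem le_tower_logStar (ℓ : ℕ) : ℓ ≤ tower (logStar ℓ) := by
  have h : (Real.logb 2)^[logStar (ℓ : ℝ)] ℓ ≤ 1 :=
    Nat.sInf_mem (exists_iterate_logb_le_one (ℓ : ℝ))
  exact_mod_cast le_tower_of_iterate_logb_le_one _ _ h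

/-- Iterated exponentials starting from `2 ^ s`. -/
def towerFrom (s : ℕ) : ℕ → ℕ
  | 0 => 2 ^ s
  | n + 1 => 2 ^ towerFrom s n

theorem tower_succ_le_towerFrom {s : ℕ} (hs : 1 ≤ s) (n : ℕ) :
    tower (n + 1) ≤ towerFrom s n := by
  induction n with
  | zero => simpa [tower, towerFrom] using Nat.pow_le_pow_right (n := 2) (by norm_num) hs
  | succ n ih => exact Nat.pow_le_pow_right (by norm_num) ih

theorem le_towerFrom (s n : ℕ) : s ≤ towerFrom s n := by
  induction n with
  | zero => exact Nat.lt_two_pow_self.le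
  | succ n ih => exact ih.trans Nat.lt_two_pow_self.le

/-- Thresholds which double `2 * s` times and grow like a tower afterwards. -/
def threshold (s i : ℕ) : ℕ :=
  if i ≤ 2 * s then 2 ^ i else 2 ^ s * towerFrom s (i - 2 * s)

theorem threshold_add (s n : ℕ) : threshold s (2 * s + n) = 2 ^ s * towerFrom s n := by
  rcases n with _ | n
  · simp [threshold, towerFrom, two_mul, pow_add]
  · simp [threshold]

/-- The two alternatives match the two trace bounds: all subsets while thresholds double,
Sauer-Shelah with dimension `2 ^ s` afterwards. The factor `2 ^ s` in `threshold` pays for the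
exponent `2 ^ s`. -/
theorem threshold_step (s i n : ℕ) (hn : n < threshold s (i + 1)) :
    2 ^ n ≤ 4 ^ threshold s i ∨ (n + 1) ^ (2 ^ s) ≤ 4 ^ threshold s i := by
  rcases Nat.lt_or_ge i (2 * s) with h | h
  · left
    have h1 : threshold s (i + 1) = 2 ^ (i + 1) := if_pos h
    have h2 : threshold s i = 2 ^ i := if_pos h.le
    rw [h2, show (4 : ℕ) = 2 ^ 2 by norm_num, ← pow_mul]
    refine Nat.pow_le_pow_right (by norm_num) ?_
    rw [h1, pow_succ] at hn
    omega
  · right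
    obtain ⟨j, rfl⟩ := Nat.exists_eq_add_of_le h
    rw [add_assoc, threshold_add] at hn
    rw [threshold_add]
    calc (n + 1) ^ (2 ^ s) ≤ (2 ^ s * 2 ^ towerFrom s j) ^ (2 ^ s) :=
          Nat.pow_le_pow_left hn _
      _ = 2 ^ ((s + towerFrom s j) * 2 ^ s) := by rw [← pow_add, ← pow_mul]
      _ ≤ 2 ^ (2 * (2 ^ s * towerFrom s j)) := by
          refine Nat.pow_le_pow_right (by norm_num) ?_
          have := le_towerFrom s j
          nlinarith [Nat.zero_le (2 ^ s)]
      _ = 4 ^ (2 ^ s * towerFrom s j) := by rw [pow_mul]; norm_num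

theorem succ_le_threshold (s i : ℕ) : i + 1 ≤ threshold s i := by
  rcases le_total i (2 * s) with h | h
  · rw [threshold, if_pos h]
    exact Nat.lt_two_pow_self
  · obtain ⟨j, rfl⟩ := Nat.exists_eq_add_of_le h
    rw [threshold_add]
    clear h
    induction j with
    | zero =>
      rw [towerFrom, ← pow_add, ← two_mul]
      exact Nat.lt_two_pow_self
    | succ j ih =>
      have h1 : towerFrom s j < towerFrom s (j + 1) := Nat.lt_two_pow_self
      have h2 : 2 ^ s * towerFrom s j < 2 ^ s * towerFrom s (j + 1) :=
        Nat.mul_lt_mul_of_pos_left h1 (by positivity)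
      omega

theorem lt_threshold_logStar {s : ℕ} (hs : 1 ≤ s) (ℓ : ℕ) :
    ℓ < threshold s (2 * s + logStar ℓ) := by
  rw [threshold_add]
  calc ℓ ≤ tower (logStar ℓ) := le_tower_logStar ℓ
    _ < tower (logStar ℓ + 1) := Nat.lt_two_pow_self
    _ ≤ towerFrom s (logStar ℓ) := tower_succ_le_towerFrom hs _
    _ ≤ _ := Nat.le_mul_of_pos_left _ (by positivity)

/-! ### Iterated fragmentation and disjoint members -/

open Finset in
theorem sum_pow_le_half {θ : ℝ} (h0 : 0 ≤ θ) (h1 : θ ≤ 1 / 3) {x : ℕ → ℕ}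
    (hx : ∀ i, i + 1 ≤ x i) (k : ℕ) : ∑ i ∈ range k, θ ^ x i ≤ 1 / 2 := by
  have h : ∀ k, ∑ i ∈ range k, θ ^ x i ≤ 1 / 2 - (1 / 2) * (1 / 3 : ℝ) ^ k := by
    intro k
    induction k with
    | zero => simp
    | succ k ih =>
      rw [sum_range_succ]
      have : θ ^ x k ≤ (1 / 3) ^ (k + 1) :=
        (pow_le_pow_of_le_one h0 (h1.trans (by norm_num)) (hx k)).trans
          (pow_le_pow_left₀ h0 h1 _)
      rw [pow_succ] at this ⊢
      linarith
  have : (0 : ℝ) ≤ (1 / 3) ^ k := by positivity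
  linarith [h k]

open Finset Classical in
/-- For a fixed set of colours `{a} × Fin k`, the family `F` is covered cheaply on average by the
union of the covers produced in the `k` steps, unless a member of `F` is coloured by `a` only. -/
theorem exists_cover_of_traces {β ι κ : Type*} [Fintype β] [DecidableEq β] [Fintype κ]
    [DecidableEq κ] (F : Finset ι)
    (s : ι → Finset β) {k : ℕ} {x : ℕ → ℕ} (hx0 : x 0 = 1) (hk : ∀ j ∈ F, #(s j) < x k)
    (htr : ∀ i A, #A < x (i + 1) → #(F.image fun j => A ∩ s j) ≤ 4 ^ x i)
    {q : ℝ} (hq : 0 ≤ q) (hKq : Fintype.card (κ × Fin k) * q ≤ 1) (a : κ) :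
    ∃ U : (β → κ × Fin k) → Fin k → Finset (Finset β),
      (∀ c, (∃ j ∈ F, ∀ v ∈ s j, (c v).1 = a) ∨ ∀ j ∈ F, ∃ i, ∃ u ∈ U c i, u ⊆ s j) ∧
      ∑ c, ∑ i, ∑ u ∈ U c i, q ^ #u ≤ Fintype.card (β → κ × Fin k) *
        ∑ i ∈ range k, (4 * (Fintype.card (κ × Fin k) * q)) ^ x i := by
  -- What is left of `s j` after the colours `(a, i')` with `i' ≥ i` are stripped: all of `s j` at
  -- `i = k`, only the points not coloured by `a` at `i = 0`.
  let R : (β → κ × Fin k) → ℕ → ι → Finset β := fun c i j =>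
    (s j).filter fun v => ¬((c v).1 = a ∧ i ≤ (c v).2)
  let G : ℕ → (β → κ × Fin k) → Finset (Finset β) := fun i c =>
    (F.image (R c i)).filter fun S => #S < x i
  have hG : ∀ i : Fin k, ∀ c, ∀ S ∈ G (i + 1) c, ∀ T ⊆ S,
      G (i + 1) (fun v => if v ∈ T then (a, i) else c v) = G (i + 1) c := by
    intro i c S hS T hT
    have hR : R (fun v => if v ∈ T then (a, i) else c v) (i + 1) = R c (i + 1) := by
      funext j
      refine filter_congr fun v _ => ?_
      by_cases hv : v ∈ T
      · obtain ⟨j', -, rfl⟩ := mem_image.1 (mem_filter.1 hS).1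
        have := (mem_filter.1 (hT hv)).2
        simp only [if_pos hv, this]
        simp
      · simp only [if_neg hv]
    simp only [G, hR]
  have hN : ∀ i : Fin k, ∀ c, ∀ S ∈ G (i + 1) c, #((G (i + 1) c).image (S ∩ ·)) ≤ 4 ^ x i := by
    intro i c S hS
    refine le_trans (card_le_card ?_) (htr i S (mem_filter.1 hS).2)
    intro B hB
    obtain ⟨T, hT, rfl⟩ := mem_image.1 hB
    obtain ⟨j, hj, rfl⟩ := mem_image.1 (mem_filter.1 hT).1
    obtain ⟨j', -, rfl⟩ := mem_image.1 (mem_filter.1 hS).1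
    refine mem_image.2 ⟨j, hj, ?_⟩
    -- `S` already avoids the stripped colours, so its traces by remainders are its traces by the
    -- original sets.
    ext v
    simp only [R, mem_inter, mem_filter]
    tauto
  choose U hU1 hU2 using fun i : Fin k => exists_fragment_cover (G (i + 1)) (a, i) (hG i)
    (4 ^ x i) (x i) (hN i) q hq hKq
  refine ⟨fun c i => U i c, fun c => ?_, ?_⟩
  · rw [or_iff_not_imp_left]
    intro hnot
    -- An uncovered remainder contains a smaller one at the previous level. At level `0` sizes are
    -- below `x 0 = 1`, so a member would be coloured by `a` alone.
    have key : ∀ i ≤ k, ∀ S ∈ G i c, ∃ i, ∃ u ∈ U i c, u ⊆ S := by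
      intro i
      induction i with
      | zero =>
        intro _ S hS
        obtain ⟨hS1, hS2⟩ := mem_filter.1 hS
        obtain ⟨j, hj, rfl⟩ := mem_image.1 hS1
        rw [hx0, Nat.lt_one_iff, card_eq_zero, filter_eq_empty_iff] at hS2
        exact absurd ⟨j, hj, fun v hv => (not_not.1 (hS2 hv)).1⟩ hnot
      | succ i ih =>
        intro hi S hS
        rcases hU1 ⟨i, hi⟩ c S hS with ⟨T, hT, hTS, hTx⟩ | h
        · obtain ⟨j, hj, rfl⟩ := mem_image.1 (mem_filter.1 hT).1
          have hR : ∀ E : Finset β, (∀ v, v ∈ E ↔ v ∈ R c (i + 1) j ∧ c v ≠ (a, ⟨i, hi⟩)) →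
              E = R c i j := by
            intro E hE
            ext v
            simp only [hE, R, mem_filter, ne_eq, Prod.ext_iff, Fin.ext_iff, and_assoc,
              and_congr_right_iff]
            intro _
            by_cases h : (c v).1 = a
            · simp only [h, true_and]; omega
            · simp [h]
          dsimp only at hTS hTx
          rw [hR _ fun v => mem_filter] at hTS hTx
          obtain ⟨i', u, hu, huS⟩ := ih (by omega) (R c i j)
            (mem_filter.2 ⟨mem_image_of_mem _ hj, hTx⟩)
          exact ⟨i', u, hu, huS.trans hTS⟩
        · exact ⟨_, h⟩
    intro j hj
    have hR : R c k j = s j := by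
      refine filter_true_of_mem fun v _ => ?_
      have := (c v).2.isLt
      omega
    have := key k le_rfl (s j) (mem_filter.2 ⟨hR ▸ mem_image_of_mem _ hj, hk j hj⟩)
    exact this
  · rw [sum_comm, mul_sum, sum_range]
    refine sum_le_sum fun i _ => (hU2 i).trans_eq ?_
    rw [Nat.cast_pow, Nat.cast_ofNat, ← mul_pow]

open Finset Classical in
/-- A spread family with few traces on small sets has many pairwise disjoint members. -/
theorem exists_disjoint_of_spread {β ι : Type*} [Fintype β] [DecidableEq β] (F : Finset ι) (hF : F.Nonempty)
    (s : ι → Finset β) {k r : ℕ} (hk0 : 0 < k) {x : ℕ → ℕ} (hx0 : x 0 = 1)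
    (hx : ∀ i, i + 1 ≤ x i) (hk : ∀ j ∈ F, #(s j) < x k)
    (htr : ∀ i A, #A < x (i + 1) → #(F.image fun j => A ∩ s j) ≤ 4 ^ x i)
    {q : ℝ} (hq : 0 ≤ q) (hqk : 24 * r * k * q ≤ 1)
    (hspread : ∀ u, (#{j ∈ F | u ⊆ s j} : ℝ) ≤ q ^ #u * #F) :
    ∃ f : Fin r → ι, (∀ a, f a ∈ F) ∧ ∀ a b, a ≠ b → Disjoint (s (f a)) (s (f b)) := by
  rcases Nat.eq_zero_or_pos r with rfl | hr
  · exact ⟨Fin.elim0, fun a => a.elim0, fun a => a.elim0⟩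
  have hcard : (Fintype.card (Fin (2 * r) × Fin k) : ℝ) = 2 * r * k := by simp
  have hpos : 0 ≤ r * k * q := by positivity
  choose U hU1 hU2 using fun a : Fin (2 * r) =>
    exists_cover_of_traces F s hx0 hk htr hq (by rw [hcard]; linarith) a
  have : Nonempty (Fin (2 * r) × Fin k) := ⟨⟨0, by omega⟩, ⟨0, hk0⟩⟩
  have hsum : ∑ c, ∑ a, ∑ i, ∑ u ∈ U a c i, q ^ #u ≤
      ∑ c : β → Fin (2 * r) × Fin k, (r : ℝ) := by
    rw [sum_comm]
    calc _ ≤ ∑ a : Fin (2 * r), Fintype.card (β → Fin (2 * r) × Fin k) * (1 / 2 : ℝ) := by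
          refine sum_le_sum fun a _ => (hU2 a).trans ?_
          gcongr
          rw [hcard]
          -- The ratio is `8 * r * k * q ≤ 1 / 3`, so each of the `2r` values of `a` costs at most
          -- `1 / 2` on average.
          exact sum_pow_le_half (by positivity) (by linarith) hx k
      _ = _ := by simp; ring
  obtain ⟨c, -, hc⟩ := exists_le_of_sum_le univ_nonempty hsum
  have hgood : r ≤ #{a : Fin (2 * r) | ∃ j ∈ F, ∀ v ∈ s j, (c v).1 = a} := by
    have hbad : (#{a : Fin (2 * r) | ¬∃ j ∈ F, ∀ v ∈ s j, (c v).1 = a} : ℝ) ≤ r := by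
      refine le_trans ?_ hc
      rw [card_eq_sum_ones, sum_filter, Nat.cast_sum]
      refine sum_le_sum fun a _ => ?_
      split_ifs with h
      · rw [Nat.cast_zero]
        exact sum_nonneg fun _ _ => sum_nonneg fun _ _ => by positivity
      · rw [Nat.cast_one]
        -- For a bad `a` the cover catches all of `F`, so spreadness makes its weight at least `1`.
        -- Total weight at most `r` leaves at least `r` good values.
        have hcov := (hU1 a c).resolve_left h
        have h0 : (0 : ℝ) < #F := by exact_mod_cast hF.card_pos
        refine le_of_mul_le_mul_right ?_ h0
        rw [one_mul]
        calc (#F : ℝ) ≤ #(univ.biUnion fun i => (U a c i).biUnion fun u => {j ∈ F | u ⊆ s j}) := by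
              refine Nat.cast_le.2 (card_le_card fun j hj => ?_)
              obtain ⟨i, u, hu, huj⟩ := hcov j hj
              simp only [mem_biUnion, mem_filter, mem_univ, true_and]
              exact ⟨i, u, hu, hj, huj⟩
          _ ≤ ((∑ i, ∑ u ∈ U a c i, #{j ∈ F | u ⊆ s j} : ℕ) : ℝ) :=
              Nat.cast_le.2 (card_biUnion_le.trans (sum_le_sum fun i _ => card_biUnion_le))
          _ ≤ (∑ i, ∑ u ∈ U a c i, q ^ #u) * #F := by
              simp only [Nat.cast_sum, sum_mul]
              exact sum_le_sum fun i _ => sum_le_sum fun u _ => hspread u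
    have htot := card_filter_add_card_filter_not (s := (univ : Finset (Fin (2 * r))))
      (fun a => ∃ j ∈ F, ∀ v ∈ s j, (c v).1 = a)
    rw [card_univ, Fintype.card_fin] at htot
    have := Nat.cast_le.1 hbad
    omega
  obtain ⟨A, hA, hAr⟩ := exists_subset_card_eq hgood
  let e : Fin r ≃ A := (A.equivFinOfCardEq hAr).symm
  have hmem : ∀ a : Fin r, ∃ j ∈ F, ∀ v ∈ s j, (c v).1 = (e a : Fin (2 * r)) := fun a =>
    (mem_filter.1 (hA (e a).2)).2
  choose f hf1 hf2 using hmem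
  refine ⟨f, hf1, fun a b hab => disjoint_left.2 fun v hva hvb => hab ?_⟩
  exact e.injective (Subtype.ext ((hf2 a v hva).symm.trans (hf2 b v hvb)))

/-! ### Passing to a spread link -/

open Finset in
/-- A large bounded family has a spread link without the empty set. -/
theorem exists_spread_link {α : Type*} [DecidableEq α] (H : Finset (Finset α)) {ℓ : ℕ}
    (hH : IsBoundedFamily ℓ H) (hℓ : 1 ≤ ℓ) {q : ℝ} (hq0 : 0 < q) (hq : 4 ≤ q)
    (hcard : q ^ ℓ ≤ #H) :
    ∃ (Z : Finset α) (F : Finset (Finset α)), F.Nonempty ∧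
      (∀ S ∈ F, S.Nonempty ∧ Disjoint S Z ∧ S ∪ Z ∈ H) ∧
      ∀ u, (#{S ∈ F | u ⊆ S} : ℝ) ≤ (4 / q) ^ #u * #F := by
  have hne : H.Nonempty := by
    rw [← card_pos]
    have : (0 : ℝ) < #H := lt_of_lt_of_le (by positivity) hcard
    exact_mod_cast this
  let μ : Finset α → ℝ := fun Z => #{S ∈ H | Z ⊆ S} * (q / 2) ^ #Z
  obtain ⟨Z, hZ, hmax⟩ := exists_max_image (H.biUnion powerset) μ
    (hne.elim fun S hS => ⟨S, mem_biUnion.2 ⟨S, hS, mem_powerset_self S⟩⟩)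
  obtain ⟨S₀, hS₀, hZS₀⟩ := mem_biUnion.1 hZ
  rw [mem_powerset] at hZS₀
  have hmax' : ∀ W, μ W ≤ μ Z := by
    intro W
    by_cases hW : ∃ S ∈ H, W ⊆ S
    · obtain ⟨S, hS, hWS⟩ := hW
      exact hmax W (mem_biUnion.2 ⟨S, hS, mem_powerset.2 hWS⟩)
    · have : #{S ∈ H | W ⊆ S} = 0 := by
        rw [card_eq_zero, filter_eq_empty_iff]
        exact fun S hS hWS => hW ⟨S, hS, hWS⟩
      simp only [μ, this, Nat.cast_zero, zero_mul]
      positivity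
  have hZcard : #Z ≤ ℓ := (card_le_card hZS₀).trans (hH S₀ hS₀)
  have hlarge : (2 : ℝ) ≤ #{S ∈ H | Z ⊆ S} := by
    have h1 : (#H : ℝ) ≤ μ Z := by simpa [μ] using hmax' ∅
    have h2 : μ Z ≤ #{S ∈ H | Z ⊆ S} * (q / 2) ^ ℓ :=
      mul_le_mul_of_nonneg_left (pow_le_pow_right₀ (by linarith) hZcard) (Nat.cast_nonneg _)
    have h3 : (2 : ℝ) ^ ℓ * (q / 2) ^ ℓ = q ^ ℓ := by rw [← mul_pow]; congr 1; ring
    have h4 : (2 : ℝ) ^ ℓ ≤ #{S ∈ H | Z ⊆ S} :=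
      le_of_mul_le_mul_right (by linarith) (show (0 : ℝ) < (q / 2) ^ ℓ by positivity)
    exact le_trans (by simpa using pow_le_pow_right₀ (one_le_two (α := ℝ)) hℓ) h4
  -- Removing `Z` keeps the link free of `∅`, so disjoint members are distinct. It loses at most
  -- half of the family; for nonempty `u` this factor `2` is absorbed in `2 ^ #u`, whence `4 / q` in
  -- place of `2 / q`.
  let E : Finset (Finset α) := {S ∈ H | Z ⊆ S}.erase Z
  have hEmem : ∀ S ∈ E, S ∈ H ∧ Z ⊆ S ∧ S ≠ Z := by
    intro S hS
    obtain ⟨h1, h2⟩ := mem_erase.1 hS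
    exact ⟨(mem_filter.1 h2).1, (mem_filter.1 h2).2, h1⟩
  have hEcard : (#{S ∈ H | Z ⊆ S} : ℝ) ≤ 2 * #E := by
    have h : #{S ∈ H | Z ⊆ S} ≤ #E + 1 := by
      have := pred_card_le_card_erase (s := {S ∈ H | Z ⊆ S}) (a := Z)
      simp only [E]
      omega
    have h' : (#{S ∈ H | Z ⊆ S} : ℝ) ≤ #E + 1 := by exact_mod_cast h
    linarith
  have hinj : Set.InjOn (· \ Z) (E : Set (Finset α)) := by
    intro S hS T hT hST
    rw [← sdiff_union_of_subset (hEmem S hS).2.1, ← sdiff_union_of_subset (hEmem T hT).2.1]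
    exact congrArg (· ∪ Z) hST
  have hFcard : #(E.image (· \ Z)) = #E := card_image_of_injOn hinj
  refine ⟨Z, E.image (· \ Z), ?_, ?_, ?_⟩
  · rw [← card_pos, hFcard]
    have : (0 : ℝ) < #E := by linarith
    exact_mod_cast this
  · intro S hS
    obtain ⟨T, hT, rfl⟩ := mem_image.1 hS
    obtain ⟨h1, h2, h3⟩ := hEmem T hT
    refine ⟨?_, sdiff_disjoint, ?_⟩
    · rw [sdiff_nonempty]
      exact fun h => h3 (h.antisymm h2)
    · rwa [sdiff_union_of_subset h2]
  · intro u
    rw [hFcard]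
    rcases u.eq_empty_or_nonempty with rfl | hu
    · simp [hFcard]
    by_cases huZ : Disjoint u Z
    · have h1 : #{S ∈ E.image (· \ Z) | u ⊆ S} ≤ #{S ∈ H | u ∪ Z ⊆ S} := by
        refine card_le_card_of_injOn (· ∪ Z) ?_ ?_
        · intro S hS
          obtain ⟨hS, huS⟩ := mem_filter.1 hS
          obtain ⟨T, hT, rfl⟩ := mem_image.1 hS
          obtain ⟨h1, h2, h3⟩ := hEmem T hT
          simp only [coe_filter, Set.mem_ofPred_eq]
          rw [sdiff_union_of_subset h2]
          exact ⟨h1, union_subset (huS.trans sdiff_subset) h2⟩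
        · intro S hS T hT hST
          obtain ⟨S, hS', rfl⟩ := mem_image.1 (mem_filter.1 hS).1
          obtain ⟨T, hT', rfl⟩ := mem_image.1 (mem_filter.1 hT).1
          have hST' : S \ Z ∪ Z = T \ Z ∪ Z := hST
          rw [sdiff_union_of_subset (hEmem S hS').2.1,
            sdiff_union_of_subset (hEmem T hT').2.1] at hST'
          rw [hST']
      have h2 := hmax' (u ∪ Z)
      simp only [μ, card_union_of_disjoint huZ, pow_add, ← mul_assoc] at h2
      have h3 : (#{S ∈ H | u ∪ Z ⊆ S} : ℝ) * (q / 2) ^ #u ≤ 2 * #E :=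
        (le_of_mul_le_mul_right h2 (by positivity)).trans hEcard
      have h4 : (#{S ∈ E.image (· \ Z) | u ⊆ S} : ℝ) ≤ #{S ∈ H | u ∪ Z ⊆ S} :=
        Nat.cast_le.2 h1
      have h5 : (2 : ℝ) ≤ 2 ^ #u := by
        simpa using pow_le_pow_right₀ (one_le_two (α := ℝ)) hu.card_pos
      have h6 : (4 / q) ^ #u * (q / 2) ^ #u = 2 ^ #u := by
        rw [← mul_pow]; congr 1; field_simp; norm_num
      refine le_of_mul_le_mul_right ?_ (show (0 : ℝ) < (q / 2) ^ #u by positivity)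
      calc _ ≤ (#{S ∈ H | u ∪ Z ⊆ S} : ℝ) * (q / 2) ^ #u := by gcongr
        _ ≤ 2 * #E := h3
        _ ≤ 2 ^ #u * #E := by gcongr
        _ = _ := by rw [← h6]; ring
    · have : #{S ∈ E.image (· \ Z) | u ⊆ S} = 0 := by
        rw [card_eq_zero, filter_eq_empty_iff]
        intro S hS huS
        obtain ⟨T, hT, rfl⟩ := mem_image.1 hS
        exact huZ (disjoint_of_subset_left huS sdiff_disjoint)
      rw [this, Nat.cast_zero]
      positivity

/-! ### Bounded VC-dimension and the theorem -/

open Finset Classical in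
/-- Pairwise disjoint members of a spread family of bounded VC-dimension. -/
theorem exists_disjoint_of_spread_of_shatters {α : Type*} [DecidableEq α]
    (F : Finset (Finset α)) (hF : F.Nonempty) {ℓ s r : ℕ} (hs : 1 ≤ s)
    (hℓ : ∀ S ∈ F, #S ≤ ℓ) (hVC : ∀ A, F.Shatters A → #A ≤ 2 ^ s)
    {q : ℝ} (hq : 0 ≤ q) (hqk : 24 * r * (2 * s + logStar ℓ : ℕ) * q ≤ 1)
    (hspread : ∀ u, (#{S ∈ F | u ⊆ S} : ℝ) ≤ q ^ #u * #F) :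
    ∃ f : Fin r → Finset α, (∀ a, f a ∈ F) ∧ ∀ a b, a ≠ b → Disjoint (f a) (f b) := by
  -- Averaging over colourings needs a finite ground set, so the argument runs on the subtype of
  -- `V`.
  let V : Finset α := F.biUnion id
  have hmap : ∀ S ∈ F, (S.subtype (· ∈ V)).map (Function.Embedding.subtype _) = S := by
    intro S hS
    exact subtype_map_of_mem fun v hv => mem_biUnion.2 ⟨S, hS, hv⟩
  have hsize : ∀ S ∈ F, #(S.subtype (· ∈ V)) < threshold s (2 * s + logStar ℓ) := by
    intro S hS
    rw [← card_map (Function.Embedding.subtype _), hmap S hS]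
    exact (hℓ S hS).trans_lt (lt_threshold_logStar hs ℓ)
  have htr : ∀ i A, #A < threshold s (i + 1) →
      #(F.image fun S => A ∩ S.subtype (· ∈ V)) ≤ 4 ^ threshold s i := by
    intro i A hA
    rcases threshold_step s i _ hA with h | h
    · exact (card_image_inter_le_two_pow F _ A).trans h
    · refine le_trans ?_ h
      refine le_trans ?_ ((card_image_inter_le F (2 ^ s) hVC
        (A.map (Function.Embedding.subtype _))).trans_eq (by rw [card_map]))
      rw [← card_map (mapEmbedding (Function.Embedding.subtype _)).toEmbedding]
      refine card_le_card fun B hB => ?_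
      obtain ⟨C, hC, rfl⟩ := mem_map.1 hB
      obtain ⟨S, hS, rfl⟩ := mem_image.1 hC
      refine mem_image.2 ⟨S, hS, ?_⟩
      change _ = (A ∩ S.subtype (· ∈ V)).map (Function.Embedding.subtype _)
      rw [map_inter, hmap S hS]
  have hspread' : ∀ u, (#{S ∈ F | u ⊆ S.subtype (· ∈ V)} : ℝ) ≤ q ^ #u * #F := by
    intro u
    refine le_trans ?_ ((hspread (u.map (Function.Embedding.subtype _))).trans_eq
      (by rw [card_map]))
    refine Nat.cast_le.2 (card_le_card fun S hS => ?_)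
    obtain ⟨hS, hu⟩ := mem_filter.1 hS
    refine mem_filter.2 ⟨hS, ?_⟩
    rw [← hmap S hS]
    exact map_subset_map.2 hu
  obtain ⟨f, hf1, hf2⟩ := exists_disjoint_of_spread (r := r) F hF
    (fun S => S.subtype (· ∈ V)) (k := 2 * s + logStar ℓ) (by omega) (x := threshold s)
    (by simp [threshold]) (succ_le_threshold s) hsize htr hq hqk hspread'
  refine ⟨f, hf1, fun a b hab => ?_⟩
  rw [← hmap _ (hf1 a), ← hmap _ (hf1 b), disjoint_map]
  exact hf2 a b hab

theorem mainTheorem1 :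
    ∃ C : ℝ, 0 < C ∧
      ∀ (α : Type*) [DecidableEq α] (H : Finset (Finset α)) (ℓ d r : ℕ),
        1 ≤ ℓ → 2 ≤ d → IsBoundedFamily ℓ H → H.vcDim ≤ d →
        C * r * (Real.logb 2 d + logStar ℓ) ≤ (H.card : ℝ) ^ (1 / (ℓ : ℝ)) →
        ∃ S : Finset (Finset α), S ⊆ H ∧ IsSunflower r S := by
  -- With spread parameter `4 / (400 * r * M)` and `k ≤ 4 * M`, the condition `24 * r * k * q ≤ 1`
  -- becomes `384 ≤ 400`.
  refine ⟨400, by norm_num, ?_⟩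
  intro α _ H ℓ d r hℓ hd hH hVC hcard
  rcases Nat.eq_zero_or_pos r with rfl | hr
  · exact ⟨∅, by simp, by simp [IsSunflower]⟩
  have hr' : (1 : ℝ) ≤ r := by exact_mod_cast hr
  have hlog : 1 ≤ Real.logb 2 d := by
    rw [Real.le_logb_iff_rpow_le (by norm_num) (by positivity)]
    simpa using hd
  set M : ℝ := Real.logb 2 d + logStar ℓ with hM
  have hM1 : 1 ≤ M := by
    have : (0 : ℝ) ≤ logStar (ℓ : ℝ) := Nat.cast_nonneg _
    linarith
  have hrM : 1 ≤ r * M := one_le_mul_of_one_le_of_one_le hr' hM1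
  have hpow : (400 * r * M) ^ ℓ ≤ (H.card : ℝ) := by
    calc (400 * r * M) ^ ℓ ≤ ((H.card : ℝ) ^ (1 / (ℓ : ℝ))) ^ ℓ :=
          pow_le_pow_left₀ (by positivity) hcard ℓ
      _ = H.card := by
          rw [one_div]
          exact Real.rpow_inv_natCast_pow (Nat.cast_nonneg _) (by omega)
  obtain ⟨Z, F, hF, hFH, hspread⟩ := exists_spread_link H hH hℓ (q := 400 * r * M)
    (by positivity) (by linarith) hpow
  let s := Nat.clog 2 d
  have hs1 : 1 ≤ s := Nat.clog_pos (by norm_num) hd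
  have hds : d ≤ 2 ^ s := Nat.le_pow_clog (by norm_num) d
  have hslog : (s : ℝ) ≤ 2 * Real.logb 2 d := by
    have h : 2 ^ (s - 1) ≤ d := (Nat.pow_pred_clog_lt_self (by norm_num) hd).le
    have h' : ((s - 1 : ℕ) : ℝ) ≤ Real.logb 2 d := by
      rw [Real.le_logb_iff_rpow_le (by norm_num) (by positivity), Real.rpow_natCast]
      exact_mod_cast h
    rw [Nat.cast_sub hs1] at h'
    push_cast at h'
    linarith
  obtain ⟨f, hf1, hf2⟩ := exists_disjoint_of_spread_of_shatters (r := r) (ℓ := ℓ) F hF hs1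
    (fun S hS => (Finset.card_le_card Finset.subset_union_left).trans (hH _ (hFH S hS).2.2))
    (fun A hA => by
      have hA' : H.Shatters A := by
        have hAZ : Disjoint A Z := by
          obtain ⟨S, hS, hAS⟩ := hA.exists_superset
          exact Finset.disjoint_of_subset_left hAS (hFH S hS).2.1
        intro B hB
        obtain ⟨S, hS, rfl⟩ := hA hB
        refine ⟨S ∪ Z, (hFH S hS).2.2, ?_⟩
        rw [Finset.inter_union_distrib_left, Finset.disjoint_iff_inter_eq_empty.1 hAZ,
          Finset.union_empty]
      exact (hA'.card_le_vcDim.trans hVC).trans hds)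
    (q := 4 / (400 * r * M)) (by positivity) (by
      have hk : ((2 * s + logStar ℓ : ℕ) : ℝ) ≤ 4 * M := by
        have : (0 : ℝ) ≤ logStar (ℓ : ℝ) := Nat.cast_nonneg _
        push_cast
        linarith
      rw [mul_div_assoc', div_le_one (by positivity)]
      have : r * ((2 * s + logStar ℓ : ℕ) : ℝ) ≤ r * (4 * M) := by gcongr
      linarith)
    hspread
  have hinj : Function.Injective f := by
    intro a b hab
    by_contra h
    have := hf2 a b h
    rw [hab, disjoint_self] at this
    exact (hFH _ (hf1 b)).1.ne_empty this
  have hinj' : Function.Injective fun a => f a ∪ Z := by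
    intro a b hab
    apply hinj
    have h := congrArg (· \ Z) hab
    simp only [Finset.union_sdiff_right] at h
    rwa [Finset.sdiff_eq_self_of_disjoint (hFH _ (hf1 a)).2.1,
      Finset.sdiff_eq_self_of_disjoint (hFH _ (hf1 b)).2.1] at h
  have hinter : ∀ A ∈ Finset.univ.image (fun a => f a ∪ Z),
      ∀ B ∈ Finset.univ.image (fun a => f a ∪ Z), A ≠ B → A ∩ B = Z := by
    intro A hA B hB hAB
    obtain ⟨a, -, rfl⟩ := Finset.mem_image.1 hA
    obtain ⟨b, -, rfl⟩ := Finset.mem_image.1 hB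
    have hab : a ≠ b := fun h => hAB (by rw [h])
    rw [← Finset.inter_union_distrib_right, Finset.disjoint_iff_inter_eq_empty.1 (hf2 a b hab),
      Finset.empty_union]
  refine ⟨Finset.univ.image fun a => f a ∪ Z, ?_, ?_, ?_⟩
  · intro S hS
    obtain ⟨a, -, rfl⟩ := Finset.mem_image.1 hS
    exact (hFH _ (hf1 a)).2.2
  · rw [Finset.card_image_of_injective _ hinj', Finset.card_univ, Fintype.card_fin]
  · intro A hA B hB hAB A' hA' B' hB' hAB'
    rw [hinter A hA B hB hAB, hinter A' hA' B' hB' hAB']
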